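/- Setting. Consider a non-relativistic complex bosonic field $\varphi(\tau,\vec x)$ (imaginary time $\tau\in\mathbb R$, $\vec x\in\mathbb R^d$, $s$ components) with $U(1)$-invariant flowing action $\Gamma_k[\varphi]=\sum_n\Gamma_k^{\{n\}}[\varphi]$, $\Gamma_k^{\{n\}}=\frac1{n!^2}\int V_n\,\varphi^{*n}\varphi^n$. For $n\ge 2$ the one-particle irreducible $n$-body vertex function $V_n$ is a locally finite complex measure on the $n$ outgoing legs (contracted with $\varphi^*$) and $n$ incoming legs (contracted with $\varphi$), symmetric in each kind of legs. Let $G_k=(\Gamma_k^{\{1\}}+R_k)^{-1}$ be the regularized propagator and $\tilde\partial_kG_k=-G_k(\partial_kR_k)G_k$ its regulator scale derivative. The flow equations are the field expansion of $\partial_k\Gamma_k=\frac12\mathrm{Tr}\,\tilde\partial_k\ln(\Gamma_k^{(2)}+R_k)$ (one-loop rings of vertices $V_b$, $b\ge2$), understood weakly against bounded measurable test functions of bounded support, with convergent loop integrals; for the propagator the flow equation is $\partial_kG_k=\tilde\partial_kG_k-G_k(\partial_k\Gamma^{\{1\}}_k)G_k$. Closeability. Arguments of $V_n$ are $m$-closeable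 if $m$, but not $m+1$, outgoing legs can simultaneously be joined to distinct incoming legs at strictly later times; the $m$-closeable part of $V_n$ is its restriction to such arguments. Assumptions (few-body limit, instantaneous microscopic interactions; $k$ in a set $K\subset\mathbb R$). $G_k$ and $\tilde\partial_kG_k$ vanish unless they propagate strictly forward in time. For $n\ge2$, $V_n$ is supported on allowed arguments: (i) the outgoing legs can be paired with the incoming legs so that no particle leaves before it enters; (ii) $V_2$ is non-closeable ($0$-closeable), and $V_n$ with $n\ge3$ has $m$-closeable parts only for $0\le m\le n-3$. Data satisfying this are called admissible. Sectors. The one-body sector is the propagator, the two-body sector is $V_2$, and for $n\ge3$ the $n$-body sector consists of the $m$-closeable parts of the $V_{n+m}$, $m\ge0$ (so for $m=0$ of the non-closeable part of $V_n$). Statement. (1) For $n\ge1$, the right-hand sides of the flow equations for the $n$-body sector depend only on the $j$-body sectors with $j\le n$: they coincide for any two admissible data (with the same $\partial_kR_k$) which agree in the $j$-body sectors, $1\le j\le n$, whatever the $j$-body sectors with $j>n$ are. (2) For admissible data, the right-hand side of the flow equation of $V_n$, $n\ge2$, is again supported on allowed arguments, and the right-hand side of that of $\Gamma^{\{1\}}$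 vanishes. (3) Hence the sectors can be solved successively, starting from $n=2$. An admissible family $(G_k,V_{n,k})_{k\in K}$ solves all flow equations if and only if it solves those for the $n$-body sector for every $n\ge1$. Whether it solves those for the $n$-body sector is determined by its $j$-body sectors with $j\le n$. Finally, suppose that the propagator satisfies $\partial_kG_k=\tilde\partial_kG_k$, and that for $n=2,3,\dots$ successively there is an admissible family which solves the flow equations for the $n$-body sector and has the same $j$-body sectors, $1\le j\le n-1$, as the family obtained in the previous step (for $n\ge3$; all these families have the given propagator). Then there is an admissible family which has, for every $n\ge2$, the $j$-body sectors with $j\le n$ of the $n$-th family, and which solves all flow equations. -/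

import Mathlib

open MeasureTheory

/-- A point of a leg of a vertex function: imaginary time, position in `ℝ^d`, and one of `s`
internal components of the complex bosonic field. -/
abbrev Pt (d s : ℕ) : Type := ℝ × EuclideanSpace ℝ (Fin d) × Fin s

/-- The arguments of an `n`-body vertex function: `n` outgoing legs (first component, the legs
contracted with `φ*`) and `n` incoming legs (second component, contracted with `φ`). -/
abbrev Legs (d s n : ℕ) : Type := (Fin n → Pt d s) × (Fin n → Pt d s)

/-- `m` outgoing legs can simultaneously be joined to `m` incoming legs by lines that run forward
in time (a line starts at an outgoing leg and ends at an incoming leg, strictly later). -/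
def ClosesWith {d s n : ℕ} (m : ℕ) (c : Legs d s n) : Prop :=
  ∃ a b : Fin m ↪ Fin n, ∀ l, (c.1 (a l)).1 < (c.2 (b l)).1

/-- The arguments at which a vertex function contributes to its `m`-closeable part: `m` forward
lines can be attached, but not `m + 1`. -/
def MCloseable {d s n : ℕ} (m : ℕ) (c : Legs d s n) : Prop :=
  ClosesWith m c ∧ ¬ ClosesWith (m + 1) c

/-- Particles run forward in time through the vertex: the outgoing legs can be paired with the
incoming ones so that no particle leaves before it enters. -/
def Causal {d s n : ℕ} (c : Legs d s n) : Prop :=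
  ∃ σ : Equiv.Perm (Fin n), ∀ i, (c.2 (σ i)).1 ≤ (c.1 i).1

/-- The arguments at which the `n`-body vertex functions, `n ≥ 2`, of a theory with instantaneous
microscopic interactions may be nonzero: causal ones, non-closeable for `n = 2`, and at most
`(n-3)`-closeable for `n ≥ 3`. (No argument qualifies for `n ≤ 1`.) -/
def Allowed {d s n : ℕ} (c : Legs d s n) : Prop :=
  Causal c ∧ ((n = 2 ∧ ¬ ClosesWith 1 c) ∨ (3 ≤ n ∧ ∀ m, ClosesWith m c → m + 3 ≤ n))

/-- The arguments at which the `b`-body vertex function belongs to the `n`-body sector: the whole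
two-body vertex for `n = 2`; for `n ≥ 3` the `m`-closeable part of the `(n+m)`-body vertex, `m ≥ 0`.
The one-body sector contains no vertex function with `b ≥ 2`; it is the propagator. -/
def sectorSet (d s n b : ℕ) : Set (Legs d s b) :=
  {c | (n = 2 ∧ b = 2) ∨ (3 ≤ n ∧ ∃ m, b = n + m ∧ MCloseable m c)}

/-- Points with time and position bounded by `R`. -/
def InBox {d s : ℕ} (R : ℝ) (x : Pt d s) : Prop := |x.1| ≤ R ∧ ‖x.2.1‖ ≤ R

/-- Argument tuples with all legs in the box of size `R`. -/
def legBox (d s n : ℕ) (R : ℝ) : Set (Legs d s n) :=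
  {c | (∀ i, InBox R (c.1 i)) ∧ ∀ i, InBox R (c.2 i)}

/-- An `n`-body vertex function as a generalized function: a locally finite complex measure on the
`2n` legs, symmetric in the outgoing and in the incoming legs, written in its (unique) polar form
`phase · var` with the total variation measure `var`. Measures are needed because instantaneous
and contact interactions are delta functions. -/
structure Vertex (d s n : ℕ) where
  var : Measure (Legs d s n)
  phase : Legs d s n → ℂ
  measurable_phase : Measurable phase
  norm_phase : ∀ c, ‖phase c‖ = 1
  locally_finite : ∀ R : ℝ, var (legBox d s n R) < ⊤
  var_symm : ∀ σ π : Equiv.Perm (Fin n),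
    var.map (fun c : Legs d s n => ((c.1 ∘ σ, c.2 ∘ π) : Legs d s n)) = var
  phase_symm : ∀ σ π : Equiv.Perm (Fin n), ∀ᵐ c ∂var, phase (c.1 ∘ σ, c.2 ∘ π) = phase c

/-- Pairing of a vertex function with a function of its arguments. -/
noncomputable def Vertex.pair {d s n : ℕ} (V : Vertex d s n) (f : Legs d s n → ℂ) : ℂ :=
  ∫ c, f c * V.phase c ∂V.var

/-- Test functions: bounded, measurable, with bounded support. -/
def IsTest {d s n : ℕ} (f : Legs d s n → ℂ) : Prop :=
  Measurable f ∧ (∃ C : ℝ, ∀ c, ‖f c‖ ≤ C) ∧ ∃ R : ℝ, ∀ c, f c ≠ 0 → c ∈ legBox d s n R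

/-- The data of the flowing action at one scale: the regularized propagator
`prop x y = ⟨φ(x) φ*(y)⟩ = (Γ^{1} + R)⁻¹(x, y)` and the one-particle irreducible `n`-body vertex
functions `vert n`. Only the `vert n` with `n ≥ 2` are used. -/
structure FlowState (d s : ℕ) where
  prop : Pt d s → Pt d s → ℂ
  measurable_prop : Measurable (Function.uncurry prop)
  vert : ∀ n, Vertex d s n

/-- The kernel `K ↦ (G K G)(x, y)`, as a function of the two legs of a one-body object `K`. -/
def dress {d s : ℕ} (G : Pt d s → Pt d s → ℂ) (x y : Pt d s) (c : Legs d s 1) : ℂ :=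
  G x (c.1 0) * G (c.2 0) y

/-- The regulator scale derivative of the regularized propagator (the scale derivative that acts
on the regulator only): `- G (∂ₖ Rₖ) G`, where `Rd` is the kernel `∂ₖ Rₖ`. -/
noncomputable def propDot {d s : ℕ} (Rd : Vertex d s 1) (G : Pt d s → Pt d s → ℂ)
    (x y : Pt d s) : ℂ :=
  - Rd.pair (dress G x y)

/-- Propagation only forward in time. -/
def Retarded {d s : ℕ} (G : Pt d s → Pt d s → ℂ) : Prop :=
  ∀ x y, x.1 ≤ y.1 → G x y = 0

/-- Few-body states: the regularized propagator and its regulator scale derivative (which is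
well defined) are retarded, and the vertex functions have allowed time arguments. -/
structure Admissible {d s : ℕ} (Rd : Vertex d s 1) (S : FlowState d s) : Prop where
  retarded : Retarded S.prop
  integrable_dot : ∀ x y, Integrable (fun c => dress S.prop x y c * Rd.phase c) Rd.var
  retarded_dot : Retarded (propDot Rd S.prop)
  allowed : ∀ n, 2 ≤ n → ∀ᵐ c ∂(S.vert n).var, Allowed c

/-! ### One-loop diagrams

Expansion in the fields of `∂ₖ Γₖ = ½ Tr ∂̃ₖ ln (Γₖ⁽²⁾ + Rₖ)` around the one-body part: rings of
`r` vertices `v : Fin r`, the vertex `v` being of body number `β v + 2`. The line `i` of the ring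
joins the vertices `i` and `finRotate r i`; it runs from the former to the latter if `o i = true`,
and in the opposite direction otherwise. A line starts at an outgoing and ends at an incoming leg.
By symmetry of the vertex functions the first legs may be used for the lines of the ring. -/

/-- The leg slot which line `i` uses at the vertex `finRotate r i` (slot `0`, unless the line
`finRotate r i` already occupies the slot `0` of the same kind). -/
def endSlot {r : ℕ} (o : Fin r → Bool) (β : Fin r → ℕ) (i : Fin r) : Fin (β (finRotate r i) + 2) :=
  if o (finRotate r i) = o i then 0 else 1

/-- The outgoing leg at which line `i` starts. -/
def outEnd {r : ℕ} (o : Fin r → Bool) (β : Fin r → ℕ) (i : Fin r) : Σ v, Fin (β v + 2) :=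
  if o i = true then ⟨i, 0⟩ else ⟨finRotate r i, endSlot o β i⟩

/-- The incoming leg at which line `i` ends. -/
def inEnd {r : ℕ} (o : Fin r → Bool) (β : Fin r → ℕ) (i : Fin r) : Σ v, Fin (β v + 2) :=
  if o i = true then ⟨finRotate r i, endSlot o β i⟩ else ⟨i, 0⟩

/-- The external outgoing legs of the ring. -/
abbrev ExtOut {r : ℕ} (o : Fin r → Bool) (β : Fin r → ℕ) : Type :=
  {l : Σ v, Fin (β v + 2) // ∀ i, outEnd o β i ≠ l}

/-- The external incoming legs of the ring. -/
abbrev ExtIn {r : ℕ} (o : Fin r → Bool) (β : Fin r → ℕ) : Type :=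
  {l : Σ v, Fin (β v + 2) // ∀ i, inEnd o β i ≠ l}

/-- The arguments of all the vertices of the ring. -/
abbrev RingLegs (d s : ℕ) {r : ℕ} (β : Fin r → ℕ) : Type := ∀ v, Legs d s (β v + 2)

/-- The value of a propagator on line `i` of the ring. -/
def lineVal {d s r : ℕ} (o : Fin r → Bool) (β : Fin r → ℕ) (G : Pt d s → Pt d s → ℂ)
    (x : RingLegs d s β) (i : Fin r) : ℂ :=
  G ((x (inEnd o β i).1).2 (inEnd o β i).2) ((x (outEnd o β i).1).1 (outEnd o β i).2)

/-- The external arguments of the ring, for a labelling of its external legs. -/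
def extLegs {d s r p : ℕ} (o : Fin r → Bool) (β : Fin r → ℕ) (e' : ExtOut o β ≃ Fin p)
    (e : ExtIn o β ≃ Fin p) (x : RingLegs d s β) : Legs d s p :=
  (fun i => (x (e'.symm i).1.1).1 (e'.symm i).1.2, fun i => (x (e.symm i).1.1).2 (e.symm i).1.2)

/-- The integrand of a ring: the regulator scale derivative of the product of its propagators
(each of them in turn being replaced by its derivative), times the phases of its vertices, times
a function `f` of the external legs. -/
noncomputable def ringIntegrand {d s r p : ℕ} (Rd : Vertex d s 1) (S : FlowState d s)
    (o : Fin r → Bool) (β : Fin r → ℕ) (e' : ExtOut o β ≃ Fin p) (e : ExtIn o β ≃ Fin p)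
    (f : Legs d s p → ℂ) (x : RingLegs d s β) : ℂ :=
  f (extLegs o β e' e x) * (∏ v, (S.vert (β v + 2)).phase (x v)) *
    ∑ j, lineVal o β (propDot Rd S.prop) x j * ∏ i ∈ Finset.univ.erase j, lineVal o β S.prop x i

/-- Product of the variation measures of the vertices of a ring. -/
noncomputable def ringMeasure {d s r : ℕ} (S : FlowState d s) (β : Fin r → ℕ) :
    Measure (RingLegs d s β) :=
  Measure.pi fun v => (S.vert (β v + 2)).var

/-- The combinatorial factor of a ring: `(-1)^(r+1) / (2r)` from the logarithm and the trace, and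
`1 / (a! a'!)` for each vertex with `a` incoming and `a'` outgoing external legs. -/
noncomputable def ringCoeff {r : ℕ} (o : Fin r → Bool) (β : Fin r → ℕ) : ℂ :=
  (-1) ^ (r + 1) / (2 * (r : ℂ)) *
    ∏ v, 1 / (((Fintype.card {a : Fin (β v + 2) // ∀ i, outEnd o β i ≠ ⟨v, a⟩}).factorial : ℂ) *
      ((Fintype.card {a : Fin (β v + 2) // ∀ i, inEnd o β i ≠ ⟨v, a⟩}).factorial : ℂ))

/-- The right-hand side of the flow equation of the `p`-body vertex function `V_p`, paired with
`f`; vertex functions are normalized by `Γ^{p}[φ] = (1/p!²) ∫ V_p φ*^p φ^p`. A ring with `p`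
external outgoing legs has at most `p` vertices, of body number at most `p + 1`; if the number of
external legs does not match, there are no labellings `e'`, `e`. -/
noncomputable def flowRHS {d s : ℕ} (Rd : Vertex d s 1) (S : FlowState d s) (p : ℕ)
    (f : Legs d s p → ℂ) : ℂ :=
  ∑ r ∈ Finset.Icc 1 p, ∑ o : Fin r → Bool, ∑ β : Fin r → Fin p,
    ringCoeff o (fun v => (β v : ℕ)) *
      ∑ e' : ExtOut o (fun v => (β v : ℕ)) ≃ Fin p, ∑ e : ExtIn o (fun v => (β v : ℕ)) ≃ Fin p,
        ∫ x, ringIntegrand Rd S o (fun v => (β v : ℕ)) e' e f x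
          ∂(ringMeasure S (fun v => (β v : ℕ)))

/-- All the loop integrals in `flowRHS` converge. -/
def FlowConverges {d s : ℕ} (Rd : Vertex d s 1) (S : FlowState d s) (p : ℕ)
    (f : Legs d s p → ℂ) : Prop :=
  ∀ r ∈ Finset.Icc 1 p, ∀ (o : Fin r → Bool) (β : Fin r → Fin p)
    (e' : ExtOut o (fun v => (β v : ℕ)) ≃ Fin p) (e : ExtIn o (fun v => (β v : ℕ)) ≃ Fin p),
    Integrable (ringIntegrand Rd S o (fun v => (β v : ℕ)) e' e f)
      (ringMeasure S (fun v => (β v : ℕ)))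

/-- The right-hand side of the flow equation of the regularized propagator,
`∂ₖ G = - G (∂ₖ Rₖ) G - G (∂ₖ Γ^{1}) G`. -/
noncomputable def propRHS {d s : ℕ} (Rd : Vertex d s 1) (S : FlowState d s) (x y : Pt d s) : ℂ :=
  propDot Rd S.prop x y - flowRHS Rd S 1 (dress S.prop x y)

/-! ### Sectors -/

/-- Two states have the same `n`-body sector: the same propagator if `n = 1`, and the same
vertex functions (as complex measures) on the arguments that belong to the `n`-body sector. -/
def AgreeSector {d s : ℕ} (n : ℕ) (S T : FlowState d s) : Prop :=
  (n = 1 → S.prop = T.prop) ∧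
  ∀ b, (S.vert b).var.restrict (sectorSet d s n b) = (T.vert b).var.restrict (sectorSet d s n b) ∧
    ∀ᵐ c ∂(S.vert b).var.restrict (sectorSet d s n b), (S.vert b).phase c = (T.vert b).phase c

/-- Test functions for the `b`-body vertex that test its part in the `n`-body sector only. -/
def IsSectorTest {d s b : ℕ} (n : ℕ) (f : Legs d s b → ℂ) : Prop :=
  IsTest f ∧ ∀ c, c ∉ sectorSet d s n b → f c = 0

/-- The right-hand sides of the flow equations for the `n`-body sector are the same in `S` and
`T` (including the convergence of the loop integrals). -/
def SameSectorFlow {d s : ℕ} (Rd : Vertex d s 1) (n : ℕ) (S T : FlowState d s) : Prop :=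
  (n = 1 → ∀ x y, (FlowConverges Rd S 1 (dress S.prop x y) ↔
      FlowConverges Rd T 1 (dress T.prop x y)) ∧ propRHS Rd S x y = propRHS Rd T x y) ∧
  ∀ (b : ℕ) (f : Legs d s b → ℂ), IsSectorTest n f →
    (FlowConverges Rd S b f ↔ FlowConverges Rd T b f) ∧ flowRHS Rd S b f = flowRHS Rd T b f

/-- The flow equation of the propagator holds for the scales in `K`. -/
def SolvesProp {d s : ℕ} (K : Set ℝ) (Rd : ℝ → Vertex d s 1) (Γ : ℝ → FlowState d s) : Prop :=
  ∀ k ∈ K, ∀ x y, FlowConverges (Rd k) (Γ k) 1 (dress (Γ k).prop x y) ∧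
    HasDerivWithinAt (fun l => (Γ l).prop x y) (propRHS (Rd k) (Γ k) x y) K k

/-- The flow equation of the `b`-body vertex function, paired with `f`, holds on `K`. -/
def SolvesVertex {d s b : ℕ} (K : Set ℝ) (Rd : ℝ → Vertex d s 1) (Γ : ℝ → FlowState d s)
    (f : Legs d s b → ℂ) : Prop :=
  ∀ k ∈ K, FlowConverges (Rd k) (Γ k) b f ∧
    HasDerivWithinAt (fun l => ((Γ l).vert b).pair f) (flowRHS (Rd k) (Γ k) b f) K k

/-- The flow equations for the `n`-body sector hold on `K`. -/
def SolvesSector {d s : ℕ} (K : Set ℝ) (Rd : ℝ → Vertex d s 1) (n : ℕ)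
    (Γ : ℝ → FlowState d s) : Prop :=
  (n = 1 → SolvesProp K Rd Γ) ∧
  ∀ (b : ℕ) (f : Legs d s b → ℂ), IsSectorTest n f → SolvesVertex K Rd Γ f

/-- The full system of flow equations, for the propagator and all vertex functions. -/
def SolvesFlow {d s : ℕ} (K : Set ℝ) (Rd : ℝ → Vertex d s 1) (Γ : ℝ → FlowState d s) : Prop :=
  SolvesProp K Rd Γ ∧
  ∀ b, 2 ≤ b → ∀ f : Legs d s b → ℂ, IsTest f → SolvesVertex K Rd Γ f

/-! ### Occupation numbers -/

/-! The proof counts particles. The occupation at time `t` is the number of incoming legs at or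
before `t` minus the number of outgoing legs strictly before `t`. By Hall's theorem with deficiency,
`m ≤ b` forward lines can be attached to a `b`-body argument exactly when at most `b - m` particles
are ever present (`ClosesWith.occupation_le`, `closesWith_of_occupation_le`). So the sector of an
allowed argument is its peak number of particles.

Occupation is additive over a ring: for the external legs it is the sum over the vertices plus one
term per line (`timeBalance_extLegs`). Causality makes the vertex terms nonnegative, forward
propagation the line terms. No vertex therefore peaks above the whole ring, and a ring in sector `n`
contains only vertices from sectors `j ≤ n`. Its integral sees only the measures restricted to those
sectors, which gives the dependence statement.

Allowed arguments are the causal ones whose peak is at least 2, and at least 3 from three bodies on.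
A ring inherits this from its vertices, except when all of them are two-body; that case needs an
argument about time ordering (`ForwardLines.exists_three_le_of_two_body`).

The rest is linearity and gluing: on allowed arguments a test function is the sum of its sector
parts, and the `b`-body vertex has no part in sectors above `b`, so it is final after step `b`. -/

/-- The sum of one function over the incoming times minus that of another over the outgoing times. -/
noncomputable def timeBalance {d s n : ℕ} (h g : ℝ → ℤ) (c : Legs d s n) : ℤ :=
  ∑ i, h (c.2 i).1 - ∑ i, g (c.1 i).1

/-- Indicator of the times up to `t`, inclusive. -/
noncomputable def upTo (t u : ℝ) : ℤ := if u ≤ t then 1 else 0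

/-- Indicator of the times before `t`. -/
noncomputable def before (t u : ℝ) : ℤ := if u < t then 1 else 0

/-- The number of particles present at time `t`, those that enter or leave at `t` included. -/
noncomputable def occupation {d s n : ℕ} (t : ℝ) (c : Legs d s n) : ℤ :=
  timeBalance (upTo t) (before t) c

theorem before_le_upTo (t u : ℝ) : before t u ≤ upTo t u := by
  unfold before upTo
  split_ifs <;> first | omega | (exfalso; linarith)

theorem upTo_nonneg (t u : ℝ) : 0 ≤ upTo t u := by
  unfold upTo; split_ifs <;> omega

theorem upTo_le_one (t u : ℝ) : upTo t u ≤ 1 := by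
  unfold upTo; split_ifs <;> omega

theorem before_nonneg (t u : ℝ) : 0 ≤ before t u := by
  unfold before; split_ifs <;> omega

theorem before_le_one (t u : ℝ) : before t u ≤ 1 := by
  unfold before; split_ifs <;> omega

/-- This is the sign of a forward line's contribution to the occupation. Strictness matters, since
legs at the very time `t` count as present. -/
theorem upTo_le_before_of_lt {t u v : ℝ} (h : u < v) : upTo t v ≤ before t u := by
  unfold before upTo
  split_ifs <;> first | omega | (exfalso; linarith)

theorem upTo_le_upTo_of_le {t u v : ℝ} (h : u ≤ v) : upTo t v ≤ upTo t u := by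
  unfold upTo
  split_ifs <;> first | omega | (exfalso; linarith)

theorem timeBalance_upTo_le_occupation {d s n : ℕ} (t : ℝ) (c : Legs d s n) :
    timeBalance (upTo t) (upTo t) c ≤ occupation t c := by
  unfold occupation timeBalance
  have := Finset.sum_le_sum fun i (_ : i ∈ Finset.univ) => before_le_upTo t (c.1 i).1
  omega

theorem Causal.timeBalance_nonneg {d s n : ℕ} {c : Legs d s n} (hc : Causal c) (t : ℝ) :
    0 ≤ timeBalance (upTo t) (upTo t) c := by
  obtain ⟨σ, hσ⟩ := hc
  unfold timeBalance
  rw [← Equiv.sum_comp σ fun i => upTo t (c.2 i).1]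
  have := Finset.sum_le_sum fun i (_ : i ∈ Finset.univ) => upTo_le_upTo_of_le (t := t) (hσ i)
  omega

theorem Causal.occupation_nonneg {d s n : ℕ} {c : Legs d s n} (hc : Causal c) (t : ℝ) :
    0 ≤ occupation t c :=
  (hc.timeBalance_nonneg t).trans (timeBalance_upTo_le_occupation t c)

/-! ### Hall's theorem: causality and closeability in terms of particle numbers -/

theorem sum_upTo_eq_card {n : ℕ} (t : ℝ) (g : Fin n → ℝ) :
    ∑ i, upTo t (g i) = ((Finset.univ.filter fun i => g i ≤ t).card : ℤ) := by
  simp [upTo]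

theorem sum_before_eq_card {n : ℕ} (t : ℝ) (g : Fin n → ℝ) :
    ∑ i, before t (g i) = ((Finset.univ.filter fun i => g i < t).card : ℤ) := by
  simp [before]

/-- By Hall's theorem, causality is nonnegativity of the number of particles at all times. -/
theorem causal_of_timeBalance_nonneg {d s n : ℕ} {c : Legs d s n}
    (hc : ∀ t, 0 ≤ timeBalance (upTo t) (upTo t) c) : Causal c := by
  classical
  have hall := (Finset.all_card_le_biUnion_card_iff_exists_injective
    fun i : Fin n => Finset.univ.filter fun j => (c.2 j).1 ≤ (c.1 i).1).1 (by
      intro A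
      rcases A.eq_empty_or_nonempty with rfl | hA
      · simp
      -- Later outgoing legs have more partners, so Hall's condition is decided by the latest leg of
      -- `A`.
      obtain ⟨a, ha, hmax⟩ := A.exists_max_image (fun i => (c.1 i).1) hA
      have h1 : A ⊆ Finset.univ.filter fun i => (c.1 i).1 ≤ (c.1 a).1 := fun i hi => by
        simpa using hmax i hi
      have h2 := hc (c.1 a).1
      unfold timeBalance at h2
      rw [sum_upTo_eq_card, sum_upTo_eq_card] at h2
      have h3 := Finset.card_le_card h1
      have h4 := Finset.card_le_card (Finset.subset_biUnion_of_mem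
        (fun i : Fin n => Finset.univ.filter fun j => (c.2 j).1 ≤ (c.1 i).1) ha)
      omega)
  obtain ⟨f, hf, hfm⟩ := hall
  exact ⟨Equiv.ofBijective f (Finite.injective_iff_bijective.1 hf), fun i => by
    simpa using hfm i⟩

/-- Lines that can be attached reduce the number of particles that can be present. -/
theorem ClosesWith.occupation_le {d s n m : ℕ} {c : Legs d s n} (hc : ClosesWith m c) (t : ℝ) :
    occupation t c ≤ (n : ℤ) - m := by
  classical
  obtain ⟨a, b, hab⟩ := hc
  -- `n - occupation t c` counts outgoing legs before `t` and incoming legs after `t`. Each attached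
  -- line has at least one such end.
  have ha : ∑ l, before t (c.1 (a l)).1 ≤ ∑ i, before t (c.1 i).1 := by
    rw [← Finset.sum_map Finset.univ a fun i => before t (c.1 i).1]
    exact Finset.sum_le_sum_of_subset_of_nonneg (Finset.subset_univ _)
      fun i _ _ => before_nonneg _ _
  have hb : ∑ l, (1 - upTo t (c.2 (b l)).1) ≤ ∑ i, (1 - upTo t (c.2 i).1) := by
    rw [← Finset.sum_map Finset.univ b fun i => 1 - upTo t (c.2 i).1]
    exact Finset.sum_le_sum_of_subset_of_nonneg (Finset.subset_univ _)
      fun i _ _ => by have := upTo_le_one t (c.2 i).1; omega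
  have hl := Finset.sum_le_sum fun l (_ : l ∈ Finset.univ) => upTo_le_before_of_lt (t := t) (hab l)
  simp only [Finset.sum_sub_distrib, Finset.sum_const, Finset.card_univ, Fintype.card_fin,
    nsmul_eq_mul, mul_one] at hb
  unfold occupation timeBalance
  omega

theorem closesWith_zero {d s n : ℕ} (c : Legs d s n) : ClosesWith 0 c :=
  ⟨⟨Fin.elim0, fun i => i.elim0⟩, ⟨Fin.elim0, fun i => i.elim0⟩, fun l => l.elim0⟩

theorem ClosesWith.mono {d s n m m' : ℕ} {c : Legs d s n} (hc : ClosesWith m c) (h : m' ≤ m) :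
    ClosesWith m' c := by
  obtain ⟨a, b, hab⟩ := hc
  exact ⟨(Fin.castLEEmb h).trans a, (Fin.castLEEmb h).trans b, fun l => hab _⟩

theorem ClosesWith.le {d s n m : ℕ} {c : Legs d s n} (hc : ClosesWith m c) : m ≤ n := by
  obtain ⟨a, -, -⟩ := hc
  simpa using Fintype.card_le_of_embedding a

theorem occupation_le_card {d s n : ℕ} (t : ℝ) (c : Legs d s n) : occupation t c ≤ n := by
  simpa using (closesWith_zero c).occupation_le t

/-- By Hall's theorem with deficiency, if at most `n - m` particles are ever present, then `m`
lines can be attached. -/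
theorem closesWith_of_occupation_le {d s n m : ℕ} {c : Legs d s n} (hm : m ≤ n)
    (hc : ∀ t, occupation t c ≤ (n : ℤ) - m) : ClosesWith m c := by
  classical
  -- The `n - m` dummy partners are open to every outgoing leg and absorb the deficiency; a matching
  -- then sends at least `m` legs to genuine incoming ones.
  have hall := (Finset.all_card_le_biUnion_card_iff_exists_injective
    fun i : Fin n => (Finset.univ.filter fun j => (c.1 i).1 < (c.2 j).1).disjSum
      (Finset.univ : Finset (Fin (n - m)))).1 (by
      intro A
      rcases A.eq_empty_or_nonempty with rfl | hA
      · simp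
      obtain ⟨a, ha, hmin⟩ := A.exists_min_image (fun i => (c.1 i).1) hA
      have h1 : A ⊆ Finset.univ.filter fun i => ¬ (c.1 i).1 < (c.1 a).1 := fun i hi => by
        simpa using hmin i hi
      have h2 := hc (c.1 a).1
      unfold occupation timeBalance at h2
      rw [sum_upTo_eq_card, sum_before_eq_card] at h2
      have h3 := Finset.card_le_card h1
      have h4 := Finset.card_le_card (Finset.subset_biUnion_of_mem
        (fun i : Fin n => (Finset.univ.filter fun j => (c.1 i).1 < (c.2 j).1).disjSum
          (Finset.univ : Finset (Fin (n - m)))) ha)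
      rw [Finset.card_disjSum, Finset.card_univ, Fintype.card_fin] at h4
      have h5 := Finset.card_filter_add_card_filter_not (s := Finset.univ)
        (fun i => (c.1 i).1 < (c.1 a).1)
      have h6 := Finset.card_filter_add_card_filter_not (s := Finset.univ)
        (fun i => (c.2 i).1 ≤ (c.1 a).1)
      simp only [not_le, Finset.card_univ, Fintype.card_fin] at h5 h6
      omega)
  obtain ⟨f, hf, hfm⟩ := hall
  let A : Finset (Fin n) := Finset.univ.filter fun i => (f i).isLeft
  have hA : m ≤ A.card := by
    have h1 := Finset.card_filter_add_card_filter_not (s := Finset.univ)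
      (fun i => (f i).isLeft = true)
    have h2 : (Finset.univ.filter fun i => ¬ (f i).isLeft = true).card ≤ n - m := by
      have h3 : (Finset.univ.filter fun i => ¬ (f i).isLeft = true).image f ⊆
          (Finset.univ : Finset (Fin (n - m))).map Function.Embedding.inr := by
        intro y hy
        obtain ⟨i, hi, rfl⟩ := Finset.mem_image.1 hy
        rw [Finset.mem_filter] at hi
        rcases hfi : f i with j | j
        · simp [hfi] at hi
        · simp
      have h4 := Finset.card_le_card h3
      rwa [Finset.card_image_of_injective _ hf, Finset.card_map, Finset.card_univ,
        Fintype.card_fin] at h4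
    rw [Finset.card_univ, Fintype.card_fin] at h1
    change m ≤ (Finset.univ.filter fun i => (f i).isLeft = true).card
    omega
  let a : Fin m ↪ Fin n := (Fin.castLEEmb hA).trans (A.orderEmbOfFin rfl).toEmbedding
  have haA : ∀ l, (f (a l)).isLeft = true := fun l =>
    (Finset.mem_filter.1 (A.orderEmbOfFin_mem rfl (Fin.castLE hA l))).2
  have hb : ∀ l, f (a l) = Sum.inl ((f (a l)).getLeft (haA l)) := fun l => by simp
  refine ⟨a, ⟨fun l => (f (a l)).getLeft (haA l), fun l l' hll => ?_⟩, fun l => ?_⟩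
  · apply a.injective
    apply hf
    rw [hb l, hb l']
    exact congrArg Sum.inl hll
  · have h := hfm (a l)
    rw [hb l] at h
    exact (Finset.mem_filter.1 (Finset.inl_mem_disjSum.1 h)).2

/-! ### Sectors and the peak number of particles -/

theorem exists_mCloseable {d s n : ℕ} (c : Legs d s n) : ∃ m, MCloseable m c := by
  classical
  have hex : ∃ m, ¬ ClosesWith (m + 1) c := ⟨n, fun h => by have := h.le; omega⟩
  refine ⟨Nat.find hex, ?_, Nat.find_spec hex⟩
  rcases h : Nat.find hex with _ | k
  · exact closesWith_zero c
  · exact not_not.1 (Nat.find_min hex (m := k) (by omega))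

theorem MCloseable.unique {d s n m m' : ℕ} {c : Legs d s n} (h : MCloseable m c)
    (h' : MCloseable m' c) : m = m' := by
  by_contra hne
  rcases lt_or_gt_of_ne hne with hlt | hlt
  · exact h.2 (h'.1.mono hlt)
  · exact h'.2 (h.1.mono hlt)

theorem Allowed.two_le {d s n : ℕ} {c : Legs d s n} (hc : Allowed c) : 2 ≤ n := by
  rcases hc.2 with ⟨h, -⟩ | ⟨h, -⟩ <;> omega

/-- If at most one particle were ever present, `n - 1` lines could be attached, more than an allowed
argument admits. -/
theorem Allowed.exists_two_le_occupation {d s n : ℕ} {c : Legs d s n} (hc : Allowed c) :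
    ∃ t, 2 ≤ occupation t c := by
  by_contra! h
  have h2 := hc.two_le
  have hcl : ClosesWith (n - 1) c :=
    closesWith_of_occupation_le (by omega) fun t => by have := h t; omega
  rcases hc.2 with ⟨rfl, h'⟩ | ⟨h3, h'⟩
  · exact h' hcl
  · have := h' _ hcl; omega

theorem Allowed.exists_three_le_occupation {d s n : ℕ} {c : Legs d s n} (hc : Allowed c)
    (hn : 3 ≤ n) : ∃ t, 3 ≤ occupation t c := by
  by_contra! h
  have hcl : ClosesWith (n - 2) c :=
    closesWith_of_occupation_le (by omega) fun t => by have := h t; omega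
  rcases hc.2 with ⟨rfl, -⟩ | ⟨-, h'⟩
  · omega
  · have := h' _ hcl; omega

/-- Particles present at a given time bound the sector from below. -/
theorem occupation_le_of_mem_sectorSet {d s n b : ℕ} {c : Legs d s b}
    (hc : c ∈ sectorSet d s n b) (t : ℝ) : occupation t c ≤ n := by
  rcases hc with ⟨rfl, rfl⟩ | ⟨-, m, rfl, h⟩
  · exact occupation_le_card t c
  · have := h.1.occupation_le t
    push_cast at this
    omega

theorem bounds_of_mem_sectorSet {d s n b : ℕ} {c : Legs d s b} (hc : c ∈ sectorSet d s n b) :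
    2 ≤ n ∧ n ≤ b := by
  rcases hc with ⟨rfl, rfl⟩ | ⟨h3, m, rfl, -⟩ <;> omega

theorem sector_unique {d s n n' b : ℕ} {c : Legs d s b} (hc : c ∈ sectorSet d s n b)
    (hc' : c ∈ sectorSet d s n' b) : n = n' := by
  rcases hc with ⟨rfl, rfl⟩ | ⟨h3, m, hm, h⟩ <;> rcases hc' with ⟨rfl, h2⟩ | ⟨h3', m', hm2, h'⟩
  · rfl
  · omega
  · omega
  · obtain rfl := h.unique h'
    exact Nat.add_right_cancel (hm.symm.trans hm2)

/-- An allowed argument belongs to a sector which is at most the largest number of particles. -/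
theorem Allowed.exists_mem_sectorSet {d s b n : ℕ} {c : Legs d s b} (hc : Allowed c)
    (hn : ∀ t, occupation t c ≤ n) : ∃ j, 1 ≤ j ∧ j ≤ n ∧ c ∈ sectorSet d s j b := by
  rcases hc.2 with ⟨h2, -⟩ | ⟨h3, h⟩
  · obtain ⟨t, ht⟩ := hc.exists_two_le_occupation
    have := hn t
    exact ⟨2, by omega, by omega, Or.inl ⟨rfl, h2⟩⟩
  · obtain ⟨m, hm⟩ := exists_mCloseable c
    have hmb := h m hm.1
    refine ⟨b - m, by omega, ?_, Or.inr ⟨by omega, m, by omega, hm⟩⟩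
    by_contra! hlt
    -- If `n < b - m`, the bound on the occupation provides `b - n ≥ m + 1` lines.
    exact hm.2 ((closesWith_of_occupation_le (m := b - n) (by omega) fun t => by
      have := hn t; omega).mono (by omega))

/-! ### Rings -/

section Rings

variable {d s r p : ℕ}

/-- Two lines can compete for a leg only at a common vertex where their orientations differ; there
`endSlot` moves one of them to slot `1`. -/
theorem outEnd_injective (o : Fin r → Bool) (β : Fin r → ℕ) :
    Function.Injective (outEnd o β) := by
  intro i j h
  unfold outEnd endSlot at h
  by_cases hi : o i = true <;> by_cases hj : o j = true
  · simp only [hi, hj, if_true] at h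
    exact congrArg Sigma.fst h
  · exfalso
    simp only [hi, hj, if_true] at h
    obtain rfl : i = finRotate r j := congrArg Sigma.fst h
    simp [hi, -finRotate_apply] at h
  · exfalso
    simp only [hi, hj, if_true] at h
    obtain rfl : finRotate r i = j := congrArg Sigma.fst h
    simp [hj, -finRotate_apply] at h
  · simp only [hi, hj] at h
    exact (finRotate r).injective (congrArg Sigma.fst h)

theorem inEnd_injective (o : Fin r → Bool) (β : Fin r → ℕ) :
    Function.Injective (inEnd o β) := by
  intro i j h
  unfold inEnd endSlot at h
  by_cases hi : o i = true <;> by_cases hj : o j = true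
  · simp only [hi, hj, if_true] at h
    exact (finRotate r).injective (congrArg Sigma.fst h)
  · exfalso
    simp only [hi, hj, if_true] at h
    obtain rfl : finRotate r i = j := congrArg Sigma.fst h
    simp [hj, -finRotate_apply] at h
  · exfalso
    simp only [hi, hj, if_true] at h
    obtain rfl : i = finRotate r j := congrArg Sigma.fst h
    simp [hi, -finRotate_apply] at h
  · simp only [hi, hj] at h
    exact congrArg Sigma.fst h

theorem ends_fst (o : Fin r → Bool) (β : Fin r → ℕ) (i : Fin r) :
    ((outEnd o β i).1 = i ∧ (inEnd o β i).1 = finRotate r i) ∨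
      ((outEnd o β i).1 = finRotate r i ∧ (inEnd o β i).1 = i) := by
  unfold outEnd inEnd
  split_ifs <;> simp

/-- Serves to separate the external legs of one kind from those occupied by lines. -/
theorem sum_compl_range_add {α : Type*} [Fintype α] {f : Fin r → α}
    [Fintype {l // ∀ i, f i ≠ l}] (hf : Function.Injective f) (h : α → ℤ) :
    ∑ l : {l // ∀ i, f i ≠ l}, h l + ∑ i, h (f i) = ∑ l, h l := by
  classical
  rw [← Finset.sum_image (s := Finset.univ) (g := f) (f := h) hf.injOn,
    ← Finset.sum_subtype (Finset.univ.image f)ᶜ (by simp) h, Finset.sum_compl_add_sum]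

/-- The external balance of a ring is the balance of its vertices minus that of its lines. -/
theorem timeBalance_extLegs (h h' : ℝ → ℤ) (o : Fin r → Bool) (β : Fin r → ℕ)
    (e' : ExtOut o β ≃ Fin p) (e : ExtIn o β ≃ Fin p) (x : RingLegs d s β) :
    timeBalance h h' (extLegs o β e' e x) = ∑ v, timeBalance h h' (x v) +
      ∑ i, (h' ((x (outEnd o β i).1).1 (outEnd o β i).2).1 -
        h ((x (inEnd o β i).1).2 (inEnd o β i).2).1) := by
  have h1 := sum_compl_range_add (inEnd_injective o β) fun l => h ((x l.1).2 l.2).1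
  have h2 := sum_compl_range_add (outEnd_injective o β) fun l => h' ((x l.1).1 l.2).1
  rw [Fintype.sum_sigma] at h1 h2
  unfold timeBalance extLegs
  rw [Equiv.sum_comp e.symm fun l : ExtIn o β => h ((x l.1.1).2 l.1.2).1,
    Equiv.sum_comp e'.symm fun l : ExtOut o β => h' ((x l.1.1).1 l.1.2).1,
    Finset.sum_sub_distrib, Finset.sum_sub_distrib]
  dsimp only at h1 h2 ⊢
  linarith

/-- Each line uses up exactly one outgoing leg. -/
theorem card_extLegs (o : Fin r → Bool) (β : Fin r → ℕ) (e' : ExtOut o β ≃ Fin p) :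
    p + r = ∑ v, (β v + 2) := by
  have h := sum_compl_range_add (outEnd_injective o β) fun _ => 1
  have hp := Fintype.card_congr e'
  simp only [Finset.sum_const, Finset.card_univ, Fintype.card_fin, mul_one,
    Fintype.card_sigma, nsmul_eq_mul] at h hp
  rw [hp] at h
  exact_mod_cast h

/-- All the lines of the ring run forward in time. -/
def ForwardLines (o : Fin r → Bool) (β : Fin r → ℕ) (x : RingLegs d s β) : Prop :=
  ∀ i, ((x (outEnd o β i).1).1 (outEnd o β i).2).1 < ((x (inEnd o β i).1).2 (inEnd o β i).2).1

variable {o : Fin r → Bool} {β : Fin r → ℕ} {x : RingLegs d s β}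

theorem ForwardLines.causal_extLegs (hl : ForwardLines o β x) (hx : ∀ v, Causal (x v))
    (e' : ExtOut o β ≃ Fin p) (e : ExtIn o β ≃ Fin p) : Causal (extLegs o β e' e x) := by
  refine causal_of_timeBalance_nonneg fun t => ?_
  rw [timeBalance_extLegs]
  refine add_nonneg (Finset.sum_nonneg fun v _ => (hx v).timeBalance_nonneg t)
    (Finset.sum_nonneg fun i _ => sub_nonneg.2 (upTo_le_upTo_of_le (hl i).le))

/-- The other vertices and all the lines contribute nonnegatively to the additive occupation. -/
theorem ForwardLines.occupation_le_extLegs (hl : ForwardLines o β x) (hx : ∀ v, Causal (x v))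
    (e' : ExtOut o β ≃ Fin p) (e : ExtIn o β ≃ Fin p) (v : Fin r) (t : ℝ) :
    occupation t (x v) ≤ occupation t (extLegs o β e' e x) := by
  unfold occupation
  rw [timeBalance_extLegs]
  exact (Finset.single_le_sum (f := fun v => occupation t (x v))
    (fun v _ => (hx v).occupation_nonneg t) (Finset.mem_univ v)).trans
    (le_add_of_nonneg_right
      (Finset.sum_nonneg fun i _ => sub_nonneg.2 (upTo_le_before_of_lt (hl i))))

theorem ForwardLines.add_le_occupation_extLegs (hl : ForwardLines o β x)
    (hx : ∀ v, Causal (x v)) (e' : ExtOut o β ≃ Fin p) (e : ExtIn o β ≃ Fin p) {v w : Fin r}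
    (hvw : v ≠ w) (t : ℝ) :
    occupation t (x v) + occupation t (x w) ≤ occupation t (extLegs o β e' e x) := by
  classical
  rw [← Finset.sum_pair (f := fun v => occupation t (x v)) hvw]
  unfold occupation
  rw [timeBalance_extLegs]
  exact (Finset.sum_le_sum_of_subset_of_nonneg (f := fun v => occupation t (x v))
    (Finset.subset_univ _) (fun v _ _ => (hx v).occupation_nonneg t)).trans
    (le_add_of_nonneg_right
      (Finset.sum_nonneg fun i _ => sub_nonneg.2 (upTo_le_before_of_lt (hl i))))

/-- A line which passes over the time `t` adds to the particles present at the vertices. -/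
theorem ForwardLines.occupation_add_one_le_extLegs (hl : ForwardLines o β x)
    (hx : ∀ v, Causal (x v)) (e' : ExtOut o β ≃ Fin p) (e : ExtIn o β ≃ Fin p) (v i : Fin r)
    {t : ℝ} (h1 : ((x (outEnd o β i).1).1 (outEnd o β i).2).1 < t)
    (h2 : t < ((x (inEnd o β i).1).2 (inEnd o β i).2).1) :
    occupation t (x v) + 1 ≤ occupation t (extLegs o β e' e x) := by
  unfold occupation
  rw [timeBalance_extLegs]
  refine add_le_add (Finset.single_le_sum (f := fun v => occupation t (x v))
    (fun v _ => (hx v).occupation_nonneg t) (Finset.mem_univ v)) ?_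
  refine le_trans ?_ (Finset.single_le_sum
    (f := fun i => before t ((x (outEnd o β i).1).1 (outEnd o β i).2).1 -
        upTo t ((x (inEnd o β i).1).2 (inEnd o β i).2).1)
    (fun i _ => sub_nonneg.2 (upTo_le_before_of_lt (hl i))) (Finset.mem_univ i))
  simp [before, upTo, h1, not_le.2 h2]

/-! ### Rings of two-body vertices only -/

theorem times_of_two_le_occupation {n : ℕ} (hn : n = 2) {c : Legs d s n} {t : ℝ}
    (hc : 2 ≤ occupation t c) : (∀ i, (c.2 i).1 ≤ t) ∧ ∀ i, t ≤ (c.1 i).1 := by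
  subst hn
  unfold occupation timeBalance at hc
  simp only [Fin.sum_univ_two] at hc
  have a0 := upTo_le_one t (c.2 0).1
  have a1 := upTo_le_one t (c.2 1).1
  have b0 := before_nonneg t (c.1 0).1
  have b1 := before_nonneg t (c.1 1).1
  have key : ∀ u, upTo t u = 1 → u ≤ t := fun u h => by
    by_contra hu; simp [upTo, hu] at h
  have key' : ∀ u, before t u = 0 → t ≤ u := fun u h => by
    by_contra! hu; simp [before, hu] at h
  refine ⟨Fin.forall_fin_two.2 ⟨key _ (by omega), key _ (by omega)⟩,
    Fin.forall_fin_two.2 ⟨key' _ (by omega), key' _ (by omega)⟩⟩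

/-- `u` plays the role of the interaction time. If the vertex is empty at `t`, both particles have
left before `t` or have yet to enter, according to the side of `u` on which `t` lies. -/
theorem occupation_eq_zero_cases {n : ℕ} (hn : n = 2) {c : Legs d s n} {t u : ℝ}
    (hu : (∀ i, (c.2 i).1 ≤ u) ∧ ∀ i, u ≤ (c.1 i).1) (hc : occupation t c ≤ 0) :
    (u < t → ∀ i, (c.1 i).1 < t) ∧ (t < u → ∀ i, t < (c.2 i).1) := by
  subst hn
  unfold occupation timeBalance at hc
  simp only [Fin.sum_univ_two] at hc
  constructor <;> intro htu
  · have a : ∀ i, upTo t (c.2 i).1 = 1 := fun i => by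
      have : (c.2 i).1 ≤ t := (hu.1 i).trans htu.le
      simp [upTo, this]
    have b0 := before_le_one t (c.1 0).1
    have b1 := before_le_one t (c.1 1).1
    have key : ∀ u, before t u = 1 → u < t := fun u h => by
      by_contra hu; simp [before, hu] at h
    rw [a, a] at hc
    exact Fin.forall_fin_two.2 ⟨key _ (by omega), key _ (by omega)⟩
  · have a : ∀ i, before t (c.1 i).1 = 0 := fun i => by
      have : ¬ (c.1 i).1 < t := not_lt.2 (htu.le.trans (hu.2 i))
      simp [before, this]
    have b0 := upTo_nonneg t (c.2 0).1
    have b1 := upTo_nonneg t (c.2 1).1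
    have key : ∀ u, upTo t u = 0 → t < u := fun u h => by
      by_contra! hu; simp [upTo, hu] at h
    rw [a, a] at hc
    exact Fin.forall_fin_two.2 ⟨key _ (by omega), key _ (by omega)⟩

theorem finRotate_distinct (hr : 3 ≤ r) (a : Fin r) :
    finRotate r a ≠ a ∧ finRotate r (finRotate r a) ≠ a := by
  obtain ⟨n, rfl⟩ : ∃ n, r = n + 3 := ⟨r - 3, by omega⟩
  simp only [finRotate_apply]
  constructor
  · simp
  · rw [add_assoc]
    simp only [ne_eq, add_eq_left]
    intro h
    have := congrArg Fin.val h
    simp [Fin.val_add] at this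
    rw [Nat.mod_eq_of_lt (by omega)] at this
    omega

/-- In a ring of at least three two-body vertices there are three particles at some time: otherwise
the vertices are separated in time, and one of the two neighbours of the first vertex interacts
while the line from that vertex to the other neighbour is present. -/
theorem ForwardLines.exists_three_le_of_two_body (hl : ForwardLines o β x)
    (hx : ∀ v, Allowed (x v)) (e' : ExtOut o β ≃ Fin p) (e : ExtIn o β ≃ Fin p)
    (hβ : ∀ v, β v + 2 = 2) (hr : 3 ≤ r) : ∃ t, 3 ≤ occupation t (extLegs o β e' e x) := by
  by_contra! hlt
  choose T hT using fun v => (hx v).exists_two_le_occupation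
  have hc : ∀ v, Causal (x v) := fun v => (hx v).1
  have hbt := fun v => times_of_two_le_occupation (hβ v) (hT v)
  -- Two particles at `v` already exhaust the assumed bound, so every other vertex is empty at `T
  -- v`.
  have hzero : ∀ v w, v ≠ w → occupation (T v) (x w) ≤ 0 := fun v w hvw => by
    have h1 := hl.add_le_occupation_extLegs hc e' e hvw (T v)
    have h2 := hlt (T v)
    have h3 := hT v
    omega
  have hinj : ∀ v w, v ≠ w → T v ≠ T w := fun v w hvw h => by
    have h1 := hzero v w hvw
    have h2 := hT w
    rw [h] at h1
    omega
  -- A line passing over `T v` would be a third particle beside the two interacting there.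
  have hline : ∀ v i, v ≠ (outEnd o β i).1 → v ≠ (inEnd o β i).1 →
      ¬ (T (outEnd o β i).1 < T v ∧ T v < T (inEnd o β i).1) := by
    rintro v i h1 h2 ⟨h3, h4⟩
    have h5 := (occupation_eq_zero_cases (hβ _) (hbt _) (hzero v _ h1)).1 h3 (outEnd o β i).2
    have h6 := (occupation_eq_zero_cases (hβ _) (hbt _) (hzero v _ h2)).2 h4 (inEnd o β i).2
    have h7 := hl.occupation_add_one_le_extLegs hc e' e v i h5 h6
    have h8 := hT v
    have h9 := hlt (T v)
    omega
  have hdir : ∀ i, T (outEnd o β i).1 < T (inEnd o β i).1 := fun i =>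
    ((hbt _).2 _).trans_lt ((hl i).trans_le ((hbt _).1 _))
  have : Nonempty (Fin r) := ⟨⟨0, by omega⟩⟩
  -- Write the earliest vertex as `finRotate r z`, with neighbours `z` and `finRotate r (finRotate r
  -- z)`. Its line to the later neighbour passes over the interaction time of the earlier one.
  obtain ⟨a, ha⟩ := Finite.exists_min T
  obtain ⟨z, rfl⟩ := (finRotate r).surjective a
  obtain ⟨hz1, hz2⟩ := finRotate_distinct hr z
  have hz3 := (finRotate_distinct hr (finRotate r z)).1
  rcases lt_or_gt_of_ne (hinj _ _ hz2) with h | h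
  · have hmin := lt_of_le_of_ne (ha (finRotate r (finRotate r z))) (hinj _ _ hz3.symm)
    have hd := hdir z
    have hli := hline (finRotate r (finRotate r z)) z
    rcases ends_fst o β z with ⟨h1, h2⟩ | ⟨h1, h2⟩ <;> rw [h1, h2] at hd hli
    · linarith
    · exact hli hz3 hz2 ⟨hmin, h⟩
  · have hmin := lt_of_le_of_ne (ha z) (hinj _ _ hz1)
    have hd := hdir (finRotate r z)
    have hli := hline z (finRotate r z)
    rcases ends_fst o β (finRotate r z) with ⟨h1, h2⟩ | ⟨h1, h2⟩ <;> rw [h1, h2] at hd hli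
    · exact hli hz1.symm hz2.symm ⟨hmin, h⟩
    · linarith

/-- The flow generates allowed arguments from allowed ones. -/
theorem ForwardLines.allowed_extLegs (hl : ForwardLines o β x) (hx : ∀ v, Allowed (x v))
    (e' : ExtOut o β ≃ Fin p) (e : ExtIn o β ≃ Fin p) (hr : 1 ≤ r) :
    Allowed (extLegs o β e' e x) := by
  have hc : ∀ v, Causal (x v) := fun v => (hx v).1
  refine ⟨hl.causal_extLegs hc e' e, ?_⟩
  obtain ⟨t, ht⟩ := (hx ⟨0, hr⟩).exists_two_le_occupation
  have ht' := ht.trans (hl.occupation_le_extLegs hc e' e ⟨0, hr⟩ t)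
  -- This excludes `p ≤ 1`, and is why the one-body right-hand side vanishes.
  have hp : (2 : ℤ) ≤ p := ht'.trans (occupation_le_card t _)
  rcases (show p = 2 ∨ 3 ≤ p by omega) with h2 | h3
  · refine Or.inl ⟨h2, fun h => ?_⟩
    have := h.occupation_le t
    omega
  · refine Or.inr ⟨h3, fun m hm => ?_⟩
    obtain ⟨u, hu⟩ : ∃ u, 3 ≤ occupation u (extLegs o β e' e x) := by
      by_cases hβ : ∀ v, β v + 2 = 2
      · refine hl.exists_three_le_of_two_body hx e' e hβ ?_
        -- Here `p + r = 2 * r`, so the ring has `r = p ≥ 3` vertices.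
        have hcard := card_extLegs o β e'
        simp only [hβ, Finset.sum_const, Finset.card_univ, Fintype.card_fin, smul_eq_mul] at hcard
        omega
      · push Not at hβ
        obtain ⟨v, hv⟩ := hβ
        obtain ⟨u, hu⟩ := (hx v).exists_three_le_occupation (by omega)
        exact ⟨u, hu.trans (hl.occupation_le_extLegs hc e' e v u)⟩
    have := hm.occupation_le u
    omega

/-- The vertices of a ring with external legs in the `n`-body sector are in the sectors `j ≤ n`. -/
theorem ForwardLines.exists_mem_sectorSet (hl : ForwardLines o β x) (hx : ∀ v, Allowed (x v))
    (e' : ExtOut o β ≃ Fin p) (e : ExtIn o β ≃ Fin p) {n : ℕ}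
    (hn : extLegs o β e' e x ∈ sectorSet d s n p) (v : Fin r) :
    ∃ j, 1 ≤ j ∧ j ≤ n ∧ x v ∈ sectorSet d s j (β v + 2) :=
  (hx v).exists_mem_sectorSet fun t =>
    (hl.occupation_le_extLegs (fun v => (hx v).1) e' e v t).trans
      (occupation_le_of_mem_sectorSet hn t)

end Rings

/-! ### Measurability -/

section Measurability

variable {d s n : ℕ}

theorem measurableSet_closesWith (m : ℕ) : MeasurableSet {c : Legs d s n | ClosesWith m c} := by
  simp only [ClosesWith, Set.ofPred_exists, Set.ofPred_forall]
  refine MeasurableSet.iUnion fun a => MeasurableSet.iUnion fun b => MeasurableSet.iInter fun l => ?_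
  exact measurableSet_lt (by fun_prop) (by fun_prop)

theorem measurableSet_sectorSet (j b : ℕ) : MeasurableSet (sectorSet d s j b) := by
  have h : sectorSet d s j b = {_c | j = 2 ∧ b = 2} ∪ ({_c | 3 ≤ j} ∩ ⋃ m, {_c | b = j + m} ∩
      ({c | ClosesWith m c} ∩ {c | ClosesWith (m + 1) c}ᶜ)) := by
    ext c
    simp [sectorSet, MCloseable]
  rw [h]
  exact (MeasurableSet.const _).union ((MeasurableSet.const _).inter (MeasurableSet.iUnion fun m =>
    (MeasurableSet.const _).inter
      ((measurableSet_closesWith m).inter (measurableSet_closesWith (m + 1)).compl)))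

theorem exists_mem_legBox (c : Legs d s n) : ∃ R : ℕ, c ∈ legBox d s n R := by
  have h : ∀ x : Pt d s, InBox (|x.1| + ‖x.2.1‖) x := fun x =>
    ⟨by linarith [norm_nonneg x.2.1], by linarith [abs_nonneg x.1]⟩
  have hm : ∀ {R R' : ℝ} {x : Pt d s}, R ≤ R' → InBox R x → InBox R' x := fun hR hx =>
    ⟨hx.1.trans hR, hx.2.trans hR⟩
  obtain ⟨R, hR⟩ := exists_nat_ge (∑ i, (|(c.1 i).1| + ‖(c.1 i).2.1‖) +
    ∑ i, (|(c.2 i).1| + ‖(c.2 i).2.1‖))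
  have h1 : 0 ≤ ∑ i, (|(c.1 i).1| + ‖(c.1 i).2.1‖) := Finset.sum_nonneg fun i _ => by positivity
  have h2 : 0 ≤ ∑ i, (|(c.2 i).1| + ‖(c.2 i).2.1‖) := Finset.sum_nonneg fun i _ => by positivity
  refine ⟨R, fun i => hm ?_ (h _), fun i => hm ?_ (h _)⟩
  · have := Finset.single_le_sum (f := fun i => |(c.1 i).1| + ‖(c.1 i).2.1‖)
      (fun i _ => by positivity) (Finset.mem_univ i)
    linarith
  · have := Finset.single_le_sum (f := fun i => |(c.2 i).1| + ‖(c.2 i).2.1‖)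
      (fun i _ => by positivity) (Finset.mem_univ i)
    linarith

/-- Needed for the product measures of rings; the boxes of integer size exhaust the space. -/
instance Vertex.sigmaFinite_var (V : Vertex d s n) : SigmaFinite V.var :=
  ⟨⟨{ set := fun R : ℕ => legBox d s n R
      set_mem := fun _ => trivial
      finite := fun R => V.locally_finite R
      spanning := Set.iUnion_eq_univ_iff.2 exists_mem_legBox }⟩⟩

end Measurability

/-! ### Test functions -/

section TestFunctions

variable {d s n : ℕ}

theorem IsTest.integrable {f : Legs d s n → ℂ} (hf : IsTest f) (V : Vertex d s n) :
    Integrable (fun c => f c * V.phase c) V.var := by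
  obtain ⟨hm, ⟨C, hC⟩, R, hR⟩ := hf
  have hon : IntegrableOn (fun c => f c * V.phase c) (legBox d s n R) V.var :=
    Measure.integrableOn_of_bounded (M := C) (V.locally_finite R).ne
      (hm.mul V.measurable_phase).aestronglyMeasurable
      (Filter.Eventually.of_forall fun c => by rw [norm_mul, V.norm_phase, mul_one]; exact hC c)
  refine (integrableOn_iff_integrable_of_support_subset fun c hc => ?_).1 hon
  exact hR c (left_ne_zero_of_mul hc)

theorem isTest_zero : IsTest (0 : Legs d s n → ℂ) :=
  ⟨measurable_zero, ⟨0, by simp⟩, 0, by simp⟩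

theorem legBox_mono {R R' : ℝ} (h : R ≤ R') : legBox d s n R ⊆ legBox d s n R' := fun _ hc =>
  ⟨fun i => ⟨(hc.1 i).1.trans h, (hc.1 i).2.trans h⟩,
    fun i => ⟨(hc.2 i).1.trans h, (hc.2 i).2.trans h⟩⟩

theorem IsTest.add {f g : Legs d s n → ℂ} (hf : IsTest f) (hg : IsTest g) : IsTest (f + g) := by
  obtain ⟨hm, ⟨C, hC⟩, R, hR⟩ := hf
  obtain ⟨hm', ⟨C', hC'⟩, R', hR'⟩ := hg
  refine ⟨hm.add hm', ⟨C + C', fun c => (norm_add_le _ _).trans (add_le_add (hC c) (hC' c))⟩,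
    max R R', fun c hc => ?_⟩
  by_cases h : f c = 0
  · exact legBox_mono (le_max_right _ _) (hR' c fun h' => hc (by simp [h, h']))
  · exact legBox_mono (le_max_left _ _) (hR c h)

theorem IsTest.indicator {f : Legs d s n → ℂ} (hf : IsTest f) {A : Set (Legs d s n)}
    (hA : MeasurableSet A) : IsTest (A.indicator f) := by
  obtain ⟨hm, ⟨C, hC⟩, R, hR⟩ := hf
  exact ⟨hm.indicator hA, ⟨C, fun c => (norm_indicator_le_norm_self f c).trans (hC c)⟩, R,
    fun c hc => hR c fun h => hc (by simp [Set.indicator, h])⟩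

theorem IsTest.isSectorTest_indicator {f : Legs d s n → ℂ} (hf : IsTest f) (j : ℕ) :
    IsSectorTest j ((sectorSet d s j n).indicator f) :=
  ⟨hf.indicator (measurableSet_sectorSet j n), fun _ hc => Set.indicator_of_notMem hc f⟩

/-- On allowed arguments a test function is the sum of its parts in the sectors. -/
theorem Allowed.sum_indicator_sectorSet {c : Legs d s n} (hc : Allowed c) (f : Legs d s n → ℂ) :
    (∑ j ∈ Finset.range (n + 1), (sectorSet d s j n).indicator f) c = f c := by
  obtain ⟨j, -, hjn, hj⟩ := hc.exists_mem_sectorSet fun t => occupation_le_card t c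
  rw [Finset.sum_apply, Finset.sum_eq_single_of_mem j (by simpa using Nat.lt_succ_of_le hjn)]
  · exact Set.indicator_of_mem hj f
  · exact fun j' _ hne => Set.indicator_of_notMem (fun hj' => hne (sector_unique hj' hj)) f

theorem Vertex.pair_add (V : Vertex d s n) {f g : Legs d s n → ℂ} (hf : IsTest f)
    (hg : IsTest g) : V.pair (f + g) = V.pair f + V.pair g := by
  unfold Vertex.pair
  rw [← integral_add (hf.integrable V) (hg.integrable V)]
  simp only [Pi.add_apply, add_mul]

theorem Admissible.pair_congr {Rd : Vertex d s 1} {S : FlowState d s} (hS : Admissible Rd S)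
    (hn : 2 ≤ n) {f g : Legs d s n → ℂ} (hfg : ∀ c, Allowed c → f c = g c) :
    (S.vert n).pair f = (S.vert n).pair g := by
  refine integral_congr_ae ?_
  filter_upwards [hS.allowed n hn] with c hc
  rw [hfg c hc]

end TestFunctions

/-! ### Ring integrals -/

section RingIntegrals

variable {d s r p : ℕ} {Rd : Vertex d s 1} {S T : FlowState d s}

theorem Retarded.lt_of_lineVal_ne_zero {G : Pt d s → Pt d s → ℂ} (hG : Retarded G)
    {o : Fin r → Bool} {β : Fin r → ℕ} {x : RingLegs d s β} {i : Fin r}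
    (h : lineVal o β G x i ≠ 0) :
    ((x (outEnd o β i).1).1 (outEnd o β i).2).1 < ((x (inEnd o β i).1).2 (inEnd o β i).2).1 :=
  not_le.1 fun hle => h (hG _ _ hle)

/-- Each term of the differentiated product puts on every line either the propagator or its
regulator derivative, and both are retarded. -/
theorem Admissible.forwardLines (hS : Admissible Rd S) {o : Fin r → Bool} {β : Fin r → ℕ}
    {e' : ExtOut o β ≃ Fin p} {e : ExtIn o β ≃ Fin p} {f : Legs d s p → ℂ} {x : RingLegs d s β}
    (h : ringIntegrand Rd S o β e' e f x ≠ 0) : ForwardLines o β x := by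
  obtain ⟨j, -, hj⟩ := Finset.exists_ne_zero_of_sum_ne_zero (right_ne_zero_of_mul h)
  intro i
  by_cases hij : i = j
  · subst hij
    exact hS.retarded_dot.lt_of_lineVal_ne_zero (left_ne_zero_of_mul hj)
  · exact hS.retarded.lt_of_lineVal_ne_zero (Finset.prod_ne_zero_iff.1 (right_ne_zero_of_mul hj) i
      (Finset.mem_erase.2 ⟨hij, Finset.mem_univ i⟩))

theorem Admissible.ae_allowed (hS : Admissible Rd S) (β : Fin r → ℕ) :
    ∀ᵐ x ∂ringMeasure S β, ∀ v, Allowed (x v) :=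
  ae_all_iff.2 fun v => Measure.tendsto_eval_ae_ae.eventually (hS.allowed (β v + 2) (by omega))

theorem ringIntegrand_congr_of_eq {o : Fin r → Bool} {β : Fin r → ℕ} {e' : ExtOut o β ≃ Fin p}
    {e : ExtIn o β ≃ Fin p} {f g : Legs d s p → ℂ} {x : RingLegs d s β}
    (h : f (extLegs o β e' e x) = g (extLegs o β e' e x)) :
    ringIntegrand Rd S o β e' e f x = ringIntegrand Rd S o β e' e g x := by
  unfold ringIntegrand
  rw [h]

/-- Only the values of test functions at allowed arguments matter in ring integrals. -/
theorem Admissible.ringIntegrand_congr (hS : Admissible Rd S) (hr : 1 ≤ r) {o : Fin r → Bool}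
    {β : Fin r → ℕ} {e' : ExtOut o β ≃ Fin p} {e : ExtIn o β ≃ Fin p} {f g : Legs d s p → ℂ}
    (hfg : ∀ c, Allowed c → f c = g c) :
    ringIntegrand Rd S o β e' e f =ᵐ[ringMeasure S β] ringIntegrand Rd S o β e' e g := by
  filter_upwards [hS.ae_allowed β] with x hx
  by_cases hl : ForwardLines o β x
  · exact ringIntegrand_congr_of_eq (hfg _ (hl.allowed_extLegs hx e' e hr))
  · rw [not_not.1 (mt hS.forwardLines hl), not_not.1 (mt hS.forwardLines hl)]

theorem Admissible.flowConverges_congr (hS : Admissible Rd S) {f g : Legs d s p → ℂ}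
    (hfg : ∀ c, Allowed c → f c = g c) (hf : FlowConverges Rd S p f) : FlowConverges Rd S p g :=
  fun r hr o β e' e => (hf r hr o β e' e).congr
    (hS.ringIntegrand_congr (Finset.mem_Icc.1 hr).1 hfg)

theorem Admissible.flowRHS_congr (hS : Admissible Rd S) {f g : Legs d s p → ℂ}
    (hfg : ∀ c, Allowed c → f c = g c) : flowRHS Rd S p f = flowRHS Rd S p g := by
  unfold flowRHS
  refine Finset.sum_congr rfl fun r hr => Finset.sum_congr rfl fun o _ =>
    Finset.sum_congr rfl fun β _ => congrArg _ (Finset.sum_congr rfl fun e' _ =>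
      Finset.sum_congr rfl fun e _ => integral_congr_ae ?_)
  exact hS.ringIntegrand_congr (Finset.mem_Icc.1 hr).1 hfg

theorem ringIntegrand_zero (o : Fin r → Bool) (β : Fin r → ℕ) (e' : ExtOut o β ≃ Fin p)
    (e : ExtIn o β ≃ Fin p) : ringIntegrand Rd S o β e' e 0 = 0 := by
  funext x
  simp [ringIntegrand]

theorem ringIntegrand_add (o : Fin r → Bool) (β : Fin r → ℕ) (e' : ExtOut o β ≃ Fin p)
    (e : ExtIn o β ≃ Fin p) (f g : Legs d s p → ℂ) :
    ringIntegrand Rd S o β e' e (f + g) =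
      ringIntegrand Rd S o β e' e f + ringIntegrand Rd S o β e' e g := by
  funext x
  simp only [ringIntegrand, Pi.add_apply, add_mul]

theorem flowConverges_zero : FlowConverges Rd S p 0 := fun r _ o β e' e => by
  rw [ringIntegrand_zero]
  exact integrable_zero _ _ _

theorem flowRHS_zero : flowRHS Rd S p 0 = 0 := by
  simp [flowRHS, ringIntegrand_zero]

theorem FlowConverges.add {f g : Legs d s p → ℂ} (hf : FlowConverges Rd S p f)
    (hg : FlowConverges Rd S p g) : FlowConverges Rd S p (f + g) := fun r hr o β e' e => by
  rw [ringIntegrand_add]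
  exact (hf r hr o β e' e).add (hg r hr o β e' e)

theorem flowRHS_add {f g : Legs d s p → ℂ} (hf : FlowConverges Rd S p f)
    (hg : FlowConverges Rd S p g) : flowRHS Rd S p (f + g) = flowRHS Rd S p f + flowRHS Rd S p g := by
  unfold flowRHS
  rw [← Finset.sum_add_distrib]
  refine Finset.sum_congr rfl fun r hr => ?_
  rw [← Finset.sum_add_distrib]
  refine Finset.sum_congr rfl fun o _ => ?_
  rw [← Finset.sum_add_distrib]
  refine Finset.sum_congr rfl fun β _ => ?_
  rw [← mul_add, ← Finset.sum_add_distrib]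
  refine congrArg _ (Finset.sum_congr rfl fun e' _ => ?_)
  rw [← Finset.sum_add_distrib]
  refine Finset.sum_congr rfl fun e _ => ?_
  rw [ringIntegrand_add]
  exact integral_add (hf r hr o β _ _) (hg r hr o β _ _)

/-- The flow generates vertex functions at allowed arguments only. -/
theorem Admissible.flowRHS_eq_zero (hS : Admissible Rd S) {f : Legs d s p → ℂ}
    (hf : ∀ c, Allowed c → f c = 0) : flowRHS Rd S p f = 0 :=
  (hS.flowRHS_congr hf).trans flowRHS_zero

theorem Admissible.flowConverges_of_eq_zero (hS : Admissible Rd S) {f : Legs d s p → ℂ}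
    (hf : ∀ c, Allowed c → f c = 0) : FlowConverges Rd S p f :=
  hS.flowConverges_congr (fun c hc => (hf c hc).symm) flowConverges_zero

theorem not_allowed_one (c : Legs d s 1) : ¬ Allowed c := fun h => by
  have := h.two_le
  omega

/-- The integrands vanish almost everywhere, so `f` may be `dress`, which need not be a test
function. -/
theorem Admissible.flowConverges_one (hS : Admissible Rd S) (f : Legs d s 1 → ℂ) :
    FlowConverges Rd S 1 f :=
  hS.flowConverges_of_eq_zero fun c hc => absurd hc (not_allowed_one c)

/-- In the few-body limit the propagator flows by its regulator scale derivative only. -/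
theorem Admissible.propRHS_eq (hS : Admissible Rd S) (x y : Pt d s) :
    propRHS Rd S x y = propDot Rd S.prop x y := by
  rw [propRHS, hS.flowRHS_eq_zero fun c hc => absurd hc (not_allowed_one c), sub_zero]

/-! ### Dependence on the sectors -/

theorem AgreeSector.symm {n : ℕ} (h : AgreeSector n S T) : AgreeSector n T S :=
  ⟨fun hn => (h.1 hn).symm, fun b => ⟨(h.2 b).1.symm, by
    rw [← (h.2 b).1]
    filter_upwards [(h.2 b).2] with c hc using hc.symm⟩⟩

theorem AgreeSector.refl (n : ℕ) (S : FlowState d s) : AgreeSector n S S :=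
  ⟨fun _ => rfl, fun _ => ⟨rfl, Filter.Eventually.of_forall fun _ => rfl⟩⟩

theorem AgreeSector.trans {n : ℕ} {U : FlowState d s} (h : AgreeSector n S T)
    (h' : AgreeSector n T U) : AgreeSector n S U :=
  ⟨fun hn => (h.1 hn).trans (h'.1 hn), fun b => ⟨(h.2 b).1.trans (h'.2 b).1, by
    have h2 := (h'.2 b).2
    rw [← (h.2 b).1] at h2
    filter_upwards [(h.2 b).2, h2] with c hST hTU using hST.trans hTU⟩⟩

/-- A vertex function has the same pairing with test functions for a sector on which it agrees. -/
theorem AgreeSector.pair_eq {n : ℕ} (h : AgreeSector n S T) {f : Legs d s p → ℂ}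
    (hf : ∀ c, c ∉ sectorSet d s n p → f c = 0) : (S.vert p).pair f = (T.vert p).pair f := by
  have hz : ∀ V : Vertex d s p, V.pair f = ∫ c in sectorSet d s n p, f c * V.phase c ∂V.var :=
    fun V => (setIntegral_eq_integral_of_forall_compl_eq_zero fun c hc => by
      rw [hf c hc, zero_mul]).symm
  rw [hz, hz, ← (h.2 p).1]
  refine integral_congr_ae ?_
  filter_upwards [(h.2 p).2] with c hc
  rw [hc]

/-- The union of the sectors `j ≤ n` of the `b`-body vertex function. -/
def sectorsUpTo (d s n b : ℕ) : Set (Legs d s b) := ⋃ j ∈ Set.Icc 1 n, sectorSet d s j b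

variable {n : ℕ}

theorem restrict_sectorsUpTo_eq (h : ∀ j, 1 ≤ j → j ≤ n → AgreeSector j S T) (b : ℕ) :
    (S.vert b).var.restrict (sectorsUpTo d s n b) =
      (T.vert b).var.restrict (sectorsUpTo d s n b) :=
  (Measure.restrict_biUnion_congr (Set.to_countable _)).2 fun j hj => ((h j hj.1 hj.2).2 b).1

theorem ae_phase_eq_sectorsUpTo (h : ∀ j, 1 ≤ j → j ≤ n → AgreeSector j S T) (b : ℕ) :
    ∀ᵐ c ∂(S.vert b).var.restrict (sectorsUpTo d s n b), (S.vert b).phase c = (T.vert b).phase c :=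
  (ae_restrict_biUnion_iff _ (Set.to_countable _) _).2 fun j hj => ((h j hj.1 hj.2).2 b).2

theorem restrict_ringMeasure_eq (h : ∀ j, 1 ≤ j → j ≤ n → AgreeSector j S T) (β : Fin r → ℕ) :
    (ringMeasure S β).restrict (Set.univ.pi fun v => sectorsUpTo d s n (β v + 2)) =
      (ringMeasure T β).restrict (Set.univ.pi fun v => sectorsUpTo d s n (β v + 2)) := by
  unfold ringMeasure
  rw [Measure.restrict_pi_pi, Measure.restrict_pi_pi]
  simp only [restrict_sectorsUpTo_eq h]

theorem ringIntegrand_ae_eq (h : ∀ j, 1 ≤ j → j ≤ n → AgreeSector j S T) (hn : 1 ≤ n)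
    (o : Fin r → Bool) (β : Fin r → ℕ)
    (e' : ExtOut o β ≃ Fin p) (e : ExtIn o β ≃ Fin p) (f : Legs d s p → ℂ) :
    ringIntegrand Rd S o β e' e f =ᵐ[(ringMeasure S β).restrict
      (Set.univ.pi fun v => sectorsUpTo d s n (β v + 2))] ringIntegrand Rd T o β e' e f := by
  have hph : ∀ᵐ x ∂(ringMeasure S β).restrict
      (Set.univ.pi fun v => sectorsUpTo d s n (β v + 2)),
      ∀ v, (S.vert (β v + 2)).phase (x v) = (T.vert (β v + 2)).phase (x v) := by
    unfold ringMeasure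
    rw [Measure.restrict_pi_pi]
    exact ae_all_iff.2 fun v => (Measure.tendsto_eval_ae_ae (i := v)
      (μ := fun v => (S.vert (β v + 2)).var.restrict (sectorsUpTo d s n (β v + 2)))).eventually
      (ae_phase_eq_sectorsUpTo h (β v + 2))
  filter_upwards [hph] with x hx
  unfold ringIntegrand
  rw [(h 1 le_rfl hn).1 rfl, Finset.prod_congr rfl fun v _ => hx v]

/-- A nonzero integrand forces forward lines and external legs in sector `n`, hence every vertex
into a sector `j ≤ n`. This localizes ring integrals to where the two states agree. -/
theorem Admissible.ringIntegrand_eq_zero_off (hS : Admissible Rd S) (o : Fin r → Bool)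
    (β : Fin r → ℕ) (e' : ExtOut o β ≃ Fin p) (e : ExtIn o β ≃ Fin p) {f : Legs d s p → ℂ}
    (hf : ∀ c, c ∉ sectorSet d s n p → f c = 0) :
    ∀ᵐ x ∂ringMeasure S β, x ∉ Set.univ.pi (fun v => sectorsUpTo d s n (β v + 2)) →
      ringIntegrand Rd S o β e' e f x = 0 := by
  filter_upwards [hS.ae_allowed β] with x hx hxA
  by_contra hne
  refine hxA fun v _ => ?_
  have hsec : extLegs o β e' e x ∈ sectorSet d s n p := by
    by_contra hc
    exact left_ne_zero_of_mul (left_ne_zero_of_mul hne) (hf _ hc)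
  obtain ⟨j, h1, h2, hj⟩ := (hS.forwardLines hne).exists_mem_sectorSet hx e' e hsec v
  exact Set.mem_biUnion (Set.mem_Icc.2 ⟨h1, h2⟩) hj

theorem integrableOn_iff_of_ae_compl_eq_zero {α : Type*} [MeasurableSpace α] {μ : Measure α}
    {A : Set α} {f : α → ℂ} (hf : ∀ᵐ x ∂μ, x ∉ A → f x = 0) :
    IntegrableOn f A μ ↔ Integrable f μ :=
  ⟨fun h => h.integrable_of_ae_notMem_eq_zero hf, fun h => h.integrableOn⟩

theorem integrable_ringIntegrand_iff (hS : Admissible Rd S) (hT : Admissible Rd T) (hn : 1 ≤ n)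
    (h : ∀ j, 1 ≤ j → j ≤ n → AgreeSector j S T) (o : Fin r → Bool)
    (β : Fin r → ℕ) (e' : ExtOut o β ≃ Fin p) (e : ExtIn o β ≃ Fin p) {f : Legs d s p → ℂ}
    (hf : ∀ c, c ∉ sectorSet d s n p → f c = 0) :
    Integrable (ringIntegrand Rd S o β e' e f) (ringMeasure S β) ↔
      Integrable (ringIntegrand Rd T o β e' e f) (ringMeasure T β) := by
  rw [← integrableOn_iff_of_ae_compl_eq_zero (hS.ringIntegrand_eq_zero_off o β e' e hf),
    ← integrableOn_iff_of_ae_compl_eq_zero (hT.ringIntegrand_eq_zero_off o β e' e hf),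
    IntegrableOn, IntegrableOn, ← restrict_ringMeasure_eq h]
  exact integrable_congr (ringIntegrand_ae_eq h hn o β e' e f)

theorem integral_ringIntegrand_eq (hS : Admissible Rd S) (hT : Admissible Rd T) (hn : 1 ≤ n)
    (h : ∀ j, 1 ≤ j → j ≤ n → AgreeSector j S T) (o : Fin r → Bool)
    (β : Fin r → ℕ) (e' : ExtOut o β ≃ Fin p) (e : ExtIn o β ≃ Fin p) {f : Legs d s p → ℂ}
    (hf : ∀ c, c ∉ sectorSet d s n p → f c = 0) :
    ∫ x, ringIntegrand Rd S o β e' e f x ∂ringMeasure S β =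
      ∫ x, ringIntegrand Rd T o β e' e f x ∂ringMeasure T β := by
  rw [← setIntegral_eq_integral_of_ae_compl_eq_zero (hS.ringIntegrand_eq_zero_off o β e' e hf),
    ← setIntegral_eq_integral_of_ae_compl_eq_zero (hT.ringIntegrand_eq_zero_off o β e' e hf),
    ← restrict_ringMeasure_eq h]
  exact integral_congr_ae (ringIntegrand_ae_eq h hn o β _ _ f)

/-- The flow equations for the `n`-body sector depend only on the sectors `j ≤ n`. -/
theorem sameSectorFlow_of_agreeSector (hS : Admissible Rd S) (hT : Admissible Rd T) (hn : 1 ≤ n)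
    (h : ∀ j, 1 ≤ j → j ≤ n → AgreeSector j S T) : SameSectorFlow Rd n S T := by
  refine ⟨fun _ x y => ⟨iff_of_true (hS.flowConverges_one _) (hT.flowConverges_one _), ?_⟩,
    fun b f hf => ⟨?_, ?_⟩⟩
  · rw [hS.propRHS_eq, hT.propRHS_eq, (h 1 le_rfl hn).1 rfl]
  · unfold FlowConverges
    simp only [integrable_ringIntegrand_iff hS hT hn h _ _ _ _ hf.2]
  · unfold flowRHS
    simp only [integral_ringIntegrand_eq hS hT hn h _ _ _ _ hf.2]

end RingIntegrals

/-! ### Solutions -/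

section Solutions

variable {d s b n : ℕ} {K : Set ℝ} {Rd : ℝ → Vertex d s 1} {Γ Γ' : ℝ → FlowState d s}

theorem solvesVertex_zero : SolvesVertex K Rd Γ (0 : Legs d s b → ℂ) := fun k _ =>
  ⟨flowConverges_zero, by
    rw [flowRHS_zero]
    simpa [Vertex.pair] using hasDerivWithinAt_const k K (0 : ℂ)⟩

theorem SolvesVertex.add {f g : Legs d s b → ℂ} (hf : IsTest f) (hg : IsTest g)
    (hfs : SolvesVertex K Rd Γ f) (hgs : SolvesVertex K Rd Γ g) :
    SolvesVertex K Rd Γ (f + g) := fun k hk => by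
  obtain ⟨hc, hd⟩ := hfs k hk
  obtain ⟨hc', hd'⟩ := hgs k hk
  refine ⟨hc.add hc', ?_⟩
  rw [flowRHS_add hc hc']
  exact (hd.add hd').congr (fun l _ => Vertex.pair_add _ hf hg) (Vertex.pair_add _ hf hg)

/-- Vertex functions and flow both live on allowed arguments; this permits replacing a test function
by the sum of its sector parts. -/
theorem SolvesVertex.congr (hΓ : ∀ k ∈ K, Admissible (Rd k) (Γ k)) (hb : 2 ≤ b)
    {f g : Legs d s b → ℂ} (hfg : ∀ c, Allowed c → f c = g c) (hf : SolvesVertex K Rd Γ f) :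
    SolvesVertex K Rd Γ g := fun k hk => by
  obtain ⟨hc, hd⟩ := hf k hk
  refine ⟨(hΓ k hk).flowConverges_congr hfg hc, ?_⟩
  rw [← (hΓ k hk).flowRHS_congr hfg]
  exact hd.congr_of_mem (fun l hl => ((hΓ l hl).pair_congr hb hfg).symm) hk

/-- There are no sectors of vertex functions with less than two bodies. -/
theorem IsSectorTest.eq_zero {f : Legs d s b → ℂ} (hf : IsSectorTest n f)
    (h : ¬ (2 ≤ n ∧ n ≤ b)) : f = 0 :=
  funext fun c => hf.2 c fun hc => h (bounds_of_mem_sectorSet hc)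

/-- The flow equations are the collection of the flow equations for the sectors. -/
theorem solvesFlow_iff (hΓ : ∀ k ∈ K, Admissible (Rd k) (Γ k)) :
    SolvesFlow K Rd Γ ↔ ∀ n, 1 ≤ n → SolvesSector K Rd n Γ := by
  constructor
  · intro h n _
    refine ⟨fun _ => h.1, fun b f hf => ?_⟩
    by_cases hb : 2 ≤ n ∧ n ≤ b
    · exact h.2 b (by omega) f hf.1
    · rw [hf.eq_zero hb]
      exact solvesVertex_zero
  · intro h
    refine ⟨(h 1 le_rfl).1 rfl, fun b hb f hf => ?_⟩
    refine SolvesVertex.congr hΓ hb (fun c hc => hc.sum_indicator_sectorSet f) ?_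
    refine (Finset.sum_induction (fun j => (sectorSet d s j b).indicator f)
      (fun g => IsTest g ∧ SolvesVertex K Rd Γ g)
      (fun g g' hg hg' => ⟨hg.1.add hg'.1, SolvesVertex.add hg.1 hg'.1 hg.2 hg'.2⟩)
      ⟨isTest_zero, solvesVertex_zero⟩ fun j _ => ?_).2
    have hj := hf.isSectorTest_indicator j
    refine ⟨hj.1, ?_⟩
    by_cases h2 : 2 ≤ j ∧ j ≤ b
    · exact (h j (by omega)).2 b _ hj
    · rw [hj.eq_zero h2]
      exact solvesVertex_zero

theorem SolvesSector.of_agreeSector (hΓ : ∀ k ∈ K, Admissible (Rd k) (Γ k))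
    (hΓ' : ∀ k ∈ K, Admissible (Rd k) (Γ' k)) (hn : 1 ≤ n)
    (h : ∀ k ∈ K, ∀ j, 1 ≤ j → j ≤ n → AgreeSector j (Γ k) (Γ' k))
    (hs : SolvesSector K Rd n Γ) : SolvesSector K Rd n Γ' := by
  have hsame := fun k hk => sameSectorFlow_of_agreeSector (hΓ k hk) (hΓ' k hk) hn (h k hk)
  refine ⟨fun h1 k hk x y => ?_, fun b f hf k hk => ?_⟩
  · obtain ⟨hc, hd⟩ := hs.1 h1 k hk x y
    obtain ⟨hiff, heq⟩ := (hsame k hk).1 h1 x y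
    refine ⟨hiff.1 hc, ?_⟩
    rw [← heq]
    -- The derivative compares different scales, so agreement is used on all of `K`, not only at
    -- `k`.
    exact hd.congr_of_mem (fun l hl => by rw [(h l hl 1 le_rfl hn).1 rfl]) hk
  · obtain ⟨hc, hd⟩ := hs.2 b f hf k hk
    obtain ⟨hiff, heq⟩ := (hsame k hk).2 b f hf
    refine ⟨hiff.1 hc, ?_⟩
    rw [← heq]
    exact hd.congr_of_mem (fun l hl => ((h l hl n hn le_rfl).pair_eq hf.2).symm) hk

/-! ### Gluing the successive solutions -/

theorem agreeSector_of_le {Γ : ℕ → FlowState d s} {j : ℕ}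
    (h : ∀ n, 2 ≤ n → j ≤ n → AgreeSector j (Γ n) (Γ (n + 1))) {n m : ℕ} (hn : 2 ≤ n)
    (hjn : j ≤ n) (hnm : n ≤ m) : AgreeSector j (Γ n) (Γ m) := by
  induction m, hnm using Nat.le_induction with
  | base => exact AgreeSector.refl j _
  | succ m hm ih => exact ih.trans (h m (hn.trans hm) (hjn.trans hm))

/-- The state whose `b`-body vertex function is taken from the `b`-th of a sequence of states. -/
def diagonalState (Γ : ℕ → FlowState d s) : FlowState d s where
  prop := (Γ 2).prop
  measurable_prop := (Γ 2).measurable_prop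
  -- The sequence matters from index 2 on; for `b < 2` the choice is immaterial, as no sector
  -- contains such a vertex.
  vert b := (Γ (max b 2)).vert b

theorem admissible_diagonalState {Rd : Vertex d s 1} {Γ : ℕ → FlowState d s}
    (h : ∀ n, 2 ≤ n → Admissible Rd (Γ n)) : Admissible Rd (diagonalState Γ) where
  retarded := (h 2 le_rfl).retarded
  integrable_dot := (h 2 le_rfl).integrable_dot
  retarded_dot := (h 2 le_rfl).retarded_dot
  allowed b hb := (h (max b 2) (le_max_right _ _)).allowed b hb

/-- Sector `j` no longer changes once the index reaches `j`, and the `b`-body vertex meets it only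
if `j ≤ b`; so the state from which that vertex is taken already has its final form. -/
theorem agreeSector_diagonalState {Γ : ℕ → FlowState d s} {j : ℕ}
    (h : ∀ n, 2 ≤ n → j ≤ n → AgreeSector j (Γ n) (Γ (n + 1))) {n : ℕ} (hn : 2 ≤ n)
    (hjn : j ≤ n) : AgreeSector j (Γ n) (diagonalState Γ) := by
  refine ⟨fun h1 => ?_, fun b => ?_⟩
  · subst h1
    exact ((agreeSector_of_le h le_rfl one_le_two hn).1 rfl).symm
  · by_cases hb : j ≤ b
    · rcases le_total n (max b 2) with hle | hle
      · exact (agreeSector_of_le h hn hjn hle).2 b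
      · exact (agreeSector_of_le h (le_max_right _ _) (hb.trans (le_max_left _ _)) hle).symm.2 b
    · have hempty : sectorSet d s j b = ∅ :=
        Set.eq_empty_of_forall_notMem fun c hc => hb (bounds_of_mem_sectorSet hc).2
      simp [hempty]

end Solutions

theorem mainTheorem2 (d s : ℕ) :
    -- the flow equations for the `n`-body sector depend only on the sectors `j ≤ n`
    (∀ (Rd : Vertex d s 1) (S T : FlowState d s), Admissible Rd S → Admissible Rd T →
      ∀ n, 1 ≤ n → (∀ j, 1 ≤ j → j ≤ n → AgreeSector j S T) → SameSectorFlow Rd n S T) ∧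
    -- the flow generates vertex functions at allowed arguments only
    (∀ (Rd : Vertex d s 1) (S : FlowState d s), Admissible Rd S →
      ∀ (b : ℕ) (f : Legs d s b → ℂ), (∀ c, Allowed c → f c = 0) → flowRHS Rd S b f = 0) ∧
    -- the flow equations are the collection of the flow equations for the sectors
    (∀ (K : Set ℝ) (Rd : ℝ → Vertex d s 1) (Γ : ℝ → FlowState d s),
      (∀ k ∈ K, Admissible (Rd k) (Γ k)) →
      (SolvesFlow K Rd Γ ↔ ∀ n, 1 ≤ n → SolvesSector K Rd n Γ)) ∧
    -- to solve those for the `n`-body sector only the sectors `j ≤ n` have to be known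
    (∀ (K : Set ℝ) (Rd : ℝ → Vertex d s 1) (Γ Γ' : ℝ → FlowState d s),
      (∀ k ∈ K, Admissible (Rd k) (Γ k)) → (∀ k ∈ K, Admissible (Rd k) (Γ' k)) →
      ∀ n, 1 ≤ n → (∀ k ∈ K, ∀ j, 1 ≤ j → j ≤ n → AgreeSector j (Γ k) (Γ' k)) →
        (SolvesSector K Rd n Γ ↔ SolvesSector K Rd n Γ')) ∧
    -- solutions for the sectors `n = 2, 3, …`, found successively, make up a full solution
    (∀ (K : Set ℝ) (Rd : ℝ → Vertex d s 1) (Γ : ℕ → ℝ → FlowState d s),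
      (∀ n, 2 ≤ n → ∀ k ∈ K, Admissible (Rd k) (Γ n k)) →
      (∀ k ∈ K, ∀ x y, HasDerivWithinAt (fun l => (Γ 2 l).prop x y)
        (propDot (Rd k) (Γ 2 k).prop x y) K k) →
      (∀ n, 2 ≤ n → SolvesSector K Rd n (Γ n)) →
      (∀ n, 2 ≤ n → ∀ k ∈ K, ∀ j, 1 ≤ j → j ≤ n → AgreeSector j (Γ n k) (Γ (n + 1) k)) →
      ∃ Γ' : ℝ → FlowState d s, (∀ k ∈ K, Admissible (Rd k) (Γ' k)) ∧
        (∀ n, 2 ≤ n → ∀ k ∈ K, ∀ j, 1 ≤ j → j ≤ n → AgreeSector j (Γ n k) (Γ' k)) ∧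
        SolvesFlow K Rd Γ') := by
  refine ⟨fun Rd S T hS hT n hn h => sameSectorFlow_of_agreeSector hS hT hn h,
    fun Rd S hS b f hf => hS.flowRHS_eq_zero hf,
    fun K Rd Γ hΓ => solvesFlow_iff hΓ,
    fun K Rd Γ Γ' hΓ hΓ' n hn h => ⟨SolvesSector.of_agreeSector hΓ hΓ' hn h,
      SolvesSector.of_agreeSector hΓ' hΓ hn fun k hk j h1 h2 => (h k hk j h1 h2).symm⟩,
    fun K Rd Γ hΓ hprop hsol hagree => ?_⟩
  have hadm : ∀ k ∈ K, Admissible (Rd k) (diagonalState fun n => Γ n k) := fun k hk =>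
    admissible_diagonalState fun n hn => hΓ n hn k hk
  have hdiag : ∀ n, 2 ≤ n → ∀ k ∈ K, ∀ j, 1 ≤ j → j ≤ n →
      AgreeSector j (Γ n k) (diagonalState fun n => Γ n k) := fun n hn k hk j hj hjn =>
    agreeSector_diagonalState (Γ := fun n => Γ n k)
      (fun m hm hjm => hagree m hm k hk j hj hjm) hn hjn
  refine ⟨fun k => diagonalState fun n => Γ n k, hadm, hdiag, (solvesFlow_iff hadm).2 ?_⟩
  intro n hn
  -- The one-body sector holds only the propagator; its loop term vanishes, so its equation is
  -- `hprop`.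
  rcases hn.eq_or_lt with rfl | hn2
  · refine ⟨fun _ k hk x y => ⟨(hadm k hk).flowConverges_one _, ?_⟩, fun b f hf => ?_⟩
    · rw [(hadm k hk).propRHS_eq]
      exact hprop k hk x y
    · rw [hf.eq_zero (by omega)]
      exact solvesVertex_zero
  · exact (hsol n hn2).of_agreeSector (hΓ n hn2) hadm hn (hdiag n hn2)
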